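/- Let $X$ be a finite abelian group with at least two elements, and let $(X,\{R_0,\dots,R_n\})$ be a (commutative) translation association scheme on $X$, that is, $(x,y)\in R_i \iff (x+z,y+z)\in R_i$; let $X_i=\{x : (0,x)\in R_i\}$ and let $v_i=|X_i|$ be the valency of $R_i$. Let $d: X\times X\to\mathbb{R}_{\ge 0}$ satisfy the triangle inequality and be constant on each relation, with value $d(i)$ on $R_i$ (so the scheme is weakly metric for $d$), and suppose that $d$ is graphical: whenever $d(x,y)>1$ there is $z$ with $d(x,z)=d(x,y)-1$ and $d(z,y)=1$. For $e \geq 0$ put $\Pi(e)=|\{i : 0\le d(i)\le e\}|$. Fix an inner product on $X$, i.e. an isomorphism $y\mapsto\langle y,\cdot\rangle$ from $X$ onto its group of complex characters. Let the dual partition of $X$ be the one in which $y,y'$ lie in the same class iff $\sum_{x\in X_i}\langle y,x\rangle=\sum_{x\in X_i}\langle y',x\rangle$ for all $i$; its classes $X_\gamma^*$ define the relations $R^*_\gamma=\{(a,b): b-a\in X^*_\gamma\}$ of the dual scheme. Let $Y$ be a subgroup of $X$, let $Y^\perp=\{x\in X : \langle y,x\rangle=1 \text{ for all } y\in Y\}$,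 and let $s$ be the number of relations of the dual scheme, other than the diagonal one, that occur between elements of $Y$. Let $e'$ be the packing radius of $Y^\perp$: the largest integer $e\ge 0$ such that the balls $\{y: d(y,c)\le e\}$, $c\in Y^\perp$, are pairwise disjoint (assumed to exist when $|Y^\perp|>1$; if $|Y^\perp|=1$, $e'$ may be any nonnegative integer). The generalized external distance of a code $C\subseteq X$ with packing radius $e$ is $s'(C)-\Pi(e)+e+1$, where $s'(C)$ is the classical external distance, i.e. the number of nontrivial classes $X^*_\gamma$ with $\frac{1}{|C|}\sum_{x,y\in C}\sum_{u\in X^*_\gamma}\langle u,y-x\rangle\neq 0$. Then the generalized external distance of $Y^\perp$ is $\mu'=s-\Pi(e')+e'+1$, and $$|Y|\le\sum_{i:\ d(i)\le\mu'} v_i .$$ Moreover, if the scheme is self-dual through the inner product (the dual partition is $\{X_0,\dots,X_n\}$), then $s$ is the number of relations $R_i$, $i\ne 0$, that occur between elements of $Y$. -/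

import Mathlib

open scoped BigOperators

/-- A commutative association scheme with `n` classes on a finite set `X`: relations
`R_0, ..., R_n` forming a partition of `X × X` (into nonempty parts) with `R_0` the diagonal,
closed under inversion, with intersection numbers `p i j k = p_{ij}^k = p_{ji}^k`. -/
structure AssocScheme (X : Type*) (n : ℕ) where
  /-- `rel i x y` means `(x, y) ∈ R_i`. -/
  rel : Fin (n + 1) → X → X → Prop
  nonempty : ∀ i, ∃ x y, rel i x y
  partition : ∀ x y, ∃! i, rel i x y
  diag : ∀ x y, rel 0 x y ↔ x = y
  /-- `R_{inv i}` is the inverse relation of `R_i`. -/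
  inv : Fin (n + 1) → Fin (n + 1)
  rel_inv : ∀ i x y, rel (inv i) x y ↔ rel i y x
  /-- the intersection numbers -/
  p : Fin (n + 1) → Fin (n + 1) → Fin (n + 1) → ℕ
  p_comm : ∀ i j k, p i j k = p j i k
  card_eq : ∀ i j k x y, rel k x y → {z : X | rel i x z ∧ rel j z y}.ncard = p i j k

namespace AssocScheme

variable {X : Type*} {n : ℕ}

/-- The valency `v_i` of the `i`-th relation: the number of `y` with `(x, y) ∈ R_i`, for any
`x` (see `ncard_rel_eq_valency`). -/
def valency (R : AssocScheme X n) (i : Fin (n + 1)) : ℕ := R.p i (R.inv i) 0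

theorem ncard_rel_eq_valency (R : AssocScheme X n) (i : Fin (n + 1)) (x : X) :
    {y : X | R.rel i x y}.ncard = R.valency i := by
  have h := R.card_eq i (R.inv i) 0 x x ((R.diag x x).2 rfl)
  simpa [R.rel_inv, valency] using h

/-- The scheme is weakly metric for `d`: `d` is a nonnegative function satisfying the triangle
inequality which takes the constant value `δ i` on the relation `R_i`. Symmetry and
`d x x = 0` are not needed; in particular every genuine distance is allowed. -/
structure IsWeaklyMetric (R : AssocScheme X n) (d : X → X → ℝ) (δ : Fin (n + 1) → ℝ) :
    Prop where
  nonneg : ∀ x y, 0 ≤ d x y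
  triangle : ∀ x y z, d x z ≤ d x y + d y z
  const : ∀ i x y, R.rel i x y → d x y = δ i

/-- The number of relations `R_i`, `i ≠ 0`, occurring between elements of `Y`. -/
noncomputable def degree (R : AssocScheme X n) (Y : Set X) : ℕ :=
  {i : Fin (n + 1) | i ≠ 0 ∧ ∃ a ∈ Y, ∃ b ∈ Y, R.rel i a b}.ncard

variable [AddCommGroup X]

/-- A translation scheme on an additive abelian group. -/
def IsTranslation (R : AssocScheme X n) : Prop :=
  ∀ i x y z, R.rel i x y ↔ R.rel i (x + z) (y + z)

/-- The class `X_i = {x | (0, x) ∈ R_i}` of a translation scheme. -/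
def cls (R : AssocScheme X n) (i : Fin (n + 1)) : Set X := {x | R.rel i 0 x}

/-- The dual partition of the character group: two characters are in the same class of the dual
scheme iff every adjacency matrix has the same eigenvalue `∑_{x ∈ X_i} χ(x)` at both, i.e. iff
they lie in the same common eigenspace of the Bose-Mesner algebra. -/
noncomputable def dualSetoid (R : AssocScheme X n) : Setoid (AddChar X ℂ) where
  r χ ψ := ∀ i, ∑ᶠ x ∈ R.cls i, χ x = ∑ᶠ x ∈ R.cls i, ψ x
  iseqv := ⟨fun _ _ => rfl, fun h i => (h i).symm, fun h h' i => (h i).trans (h' i)⟩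

/-- The index set of the classes of the dual scheme
(equivalently, of the primitive idempotents `E_γ = |X|⁻¹ [∑_{χ ∈ γ} χ (y - x)]_{x,y}`). -/
abbrev DualClass (R : AssocScheme X n) : Type _ := Quotient R.dualSetoid

/-- The class of a character in the dual scheme. -/
noncomputable def dualClass (R : AssocScheme X n) (χ : AddChar X ℂ) : R.DualClass :=
  Quotient.mk R.dualSetoid χ

/-- The `γ`-component `∑_i a_i Q_γ(i)` of the dual (MacWilliams) distribution of a code `C` with
inner distribution `a_i = |R_i ∩ C²| / |C|`; here `Q_γ(i) = ∑_{χ ∈ γ} χ (y - x)` whenever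
`(x, y) ∈ R_i`, so that it is `|C|⁻¹ ∑_{x, y ∈ C} ∑_{χ ∈ γ} χ (y - x)`. -/
noncomputable def dualDistribution (R : AssocScheme X n) (C : Set X) (γ : R.DualClass) : ℂ :=
  (C.ncard : ℂ)⁻¹ *
    ∑ᶠ x ∈ C, ∑ᶠ y ∈ C, ∑ᶠ χ ∈ {χ : AddChar X ℂ | R.dualClass χ = γ}, χ (y - x)

/-- The (classical) external distance of a code: the number of nonzero components of its dual
distribution, the one of the trivial class excluded. -/
noncomputable def externalDistance (R : AssocScheme X n) (C : Set X) : ℕ :=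
  {γ : R.DualClass | γ ≠ R.dualClass 0 ∧ R.dualDistribution C γ ≠ 0}.ncard

/-- For an identification `φ` of `X` with its character group: the number of nontrivial classes
of the dual scheme met by (the image of) the subgroup `Y`, that is, the number of nontrivial
relations of the dual scheme which occur between elements of `Y`. -/
noncomputable def dualDegree (R : AssocScheme X n) (φ : X ≃+ AddChar X ℂ)
    (Y : AddSubgroup X) : ℕ :=
  {γ : R.DualClass | γ ≠ R.dualClass 0 ∧
    ∃ a ∈ Y, ∃ b ∈ Y, R.dualClass (φ b - φ a) = γ}.ncard

/-- `φ` identifies the translation scheme with its dual: it maps the partition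
`{X_i}` of `X` to the dual partition of the character group. -/
def IsSelfDualVia (R : AssocScheme X n) (φ : X ≃+ AddChar X ℂ) : Prop :=
  ∀ x y, (∃ i, x ∈ R.cls i ∧ y ∈ R.cls i) ↔ R.dualClass (φ x) = R.dualClass (φ y)

/-- The generalized external distance `s' - Π(e) + e + 1` of a code `C` with packing radius `e`,
where `Π` is the dispersion function `Pi`. -/
noncomputable def genExternalDistance (R : AssocScheme X n) (Pi : ℝ → ℕ) (C : Set X)
    (e : ℕ) : ℤ :=
  (R.externalDistance C : ℤ) - (Pi e : ℤ) + (e : ℤ) + 1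

end AssocScheme

/-- The dispersion function `Π(e)`: the number of indices `i` with `0 ≤ d(i) ≤ e`. -/
noncomputable def dispersion {n : ℕ} (δ : Fin (n + 1) → ℝ) (e : ℝ) : ℕ :=
  {i : Fin (n + 1) | 0 ≤ δ i ∧ δ i ≤ e}.ncard

/-- A distance is graphical if whenever `d x y > 1` there is `z` with `d x z = d x y - 1` and
`d z y = 1`. -/
def IsGraphical {X : Type*} (d : X → X → ℝ) : Prop :=
  ∀ x y, 1 < d x y → ∃ z, d x z = d x y - 1 ∧ d z y = 1

/-- The ball `B(c, e) = {y | d(y, c) ≤ e}`. -/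
def codeBall {X : Type*} (d : X → X → ℝ) (c : X) (e : ℝ) : Set X := {y | d y c ≤ e}

/-- `e` is the packing radius of `C`: the largest integer for which the balls of radius `e`
around the elements of `C` are pairwise disjoint. For a code with a single element, where
there is no largest one, every `e` is accepted. -/
def IsPackingRadius {X : Type*} (d : X → X → ℝ) (C : Set X) (e : ℕ) : Prop :=
  C.PairwiseDisjoint (fun c => codeBall d c e) ∧
    (C.Nontrivial → ¬ C.PairwiseDisjoint (fun c => codeBall d c ((e : ℝ) + 1)))

/-- The dual `Y^⊥ = {x | φ(y)(x) = 1 for all y ∈ Y}` of a subgroup `Y`, with respect to an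
identification `φ` of `X` with its character group. -/
def perp {X : Type*} [AddCommGroup X] (φ : X ≃+ AddChar X ℂ) (Y : AddSubgroup X) :
    AddSubgroup X where
  carrier := {x | ∀ y ∈ Y, φ y x = 1}
  zero_mem' := fun _ _ => AddChar.map_zero_eq_one _
  add_mem' := fun {a b} ha hb y hy => by
    rw [AddChar.map_add_eq_mul, ha y hy, hb y hy, mul_one]
  neg_mem' := fun {a} ha y hy => by
    have h := AddChar.map_add_eq_mul (φ y) (-a) a
    rw [neg_add_cancel, AddChar.map_zero_eq_one, ha y hy, mul_one] at h
    exact h.symm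

/-!
Translation invariance diagonalises every adjacency matrix by characters, so the outer distribution
matrix of a code `C`, whose columns are `x ↦ |{c ∈ C | (x, c) ∈ R_i}|`, has its column space in the
span of the components of `1_C` in those common eigenspaces where the dual distribution of `C` does
not vanish; its rank is at most `s'(C) + 1`. If some point `x` lay at distance greater than
`μ' = e + k` from `C`, where `k = s'(C) + 1 - Π(e)`, then moving from `x` towards `C` along the
graphical distance gives points at distance exactly `e + 1, …, e + k` from `C`. Take one relation
for each of these distances and for the distance of `x`, together with the `Π(e)` relations of
length at most `e`; since balls of radius `e` around codewords are disjoint, a point is in at most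
one of the latter relations with a codeword. Restricted to suitable rows, these `s'(C) + 2` columns
are therefore triangular when ordered by length, contradicting the rank bound.

So the balls of radius `μ'` around `C` cover `X`. For `C = Y^⊥` the identity `|Y| |Y^⊥| = |X|`
turns this covering into the bound on `|Y|`, and `s'(Y^⊥) = s` because the characters trivial on
`Y^⊥` are exactly those coming from `Y`.
-/

section Characters

variable {X : Type*} [AddCommGroup X]

open scoped Classical in
theorem finsum_mem_addSubgroup_addChar {K : Type*} [CommRing K] [IsDomain K] (C : AddSubgroup X)
    [Finite C] (χ : AddChar X K) :
    ∑ᶠ x ∈ (C : Set X), χ x = if ∀ c ∈ C, χ c = 1 then (Nat.card C : K) else 0 := by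
  have := Fintype.ofFinite C
  have htriv : χ.compAddMonoidHom C.subtype = 0 ↔ ∀ c ∈ C, χ c = 1 := by
    simp [DFunLike.ext_iff]
  have hsum := AddChar.sum_eq_ite (χ.compAddMonoidHom C.subtype)
  simp only [htriv, ← Nat.card_eq_fintype_card] at hsum
  rw [← hsum, ← finsum_set_coe_eq_finsum_mem, finsum_eq_sum_of_fintype]
  rfl

theorem finsum_mem_addSubgroup_addChar_ne_zero_iff {K : Type*} [CommRing K] [IsDomain K]
    [CharZero K] (C : AddSubgroup X) [Finite C] (χ : AddChar X K) :
    ∑ᶠ x ∈ (C : Set X), χ x ≠ 0 ↔ ∀ c ∈ C, χ c = 1 := by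
  classical
  rw [finsum_mem_addSubgroup_addChar, Ne, ite_eq_right_iff, not_forall]
  simp [Nat.card_pos.ne']

variable [Finite X]

open scoped Classical in
theorem finsum_mem_apply_eq_ite_mem_perp (φ : X ≃+ AddChar X ℂ) (Y : AddSubgroup X) (x : X) :
    ∑ᶠ y ∈ (Y : Set X), φ y x = if x ∈ perp φ Y then (Nat.card Y : ℂ) else 0 :=
  finsum_mem_addSubgroup_addChar Y
    ((AddChar.doubleDualEmb x).compAddMonoidHom φ.toAddMonoidHom)

open scoped Classical in
theorem card_mul_finsum_mem_perp (φ : X ≃+ AddChar X ℂ) (Y : AddSubgroup X)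
    (χ : AddChar X ℂ) :
    (Nat.card Y : ℂ) * ∑ᶠ c ∈ (perp φ Y : Set X), χ c =
      if φ.symm χ ∈ Y then (Nat.card X : ℂ) else 0 := by
  have := Fintype.ofFinite X
  calc (Nat.card Y : ℂ) * ∑ᶠ c ∈ (perp φ Y : Set X), χ c
      = ∑ x, χ x * ∑ᶠ y ∈ (Y : Set X), φ y (-x) := by
        simp only [finsum_mem_apply_eq_ite_mem_perp, neg_mem_iff, mul_ite, mul_zero]
        rw [finsum_mem_eq_toFinset_sum, Finset.mul_sum, ← Finset.sum_filter]
        exact Finset.sum_congr (by ext; simp) fun c _ => mul_comm _ _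
    _ = ∑ y ∈ (Y : Set X).toFinset, ∑ x, (χ - φ y) x := by
        simp only [finsum_mem_eq_toFinset_sum, Finset.mul_sum, AddChar.sub_apply]
        exact Finset.sum_comm
    _ = ∑ y ∈ (Y : Set X).toFinset, if φ.symm χ = y then (Nat.card X : ℂ) else 0 := by
        simp only [AddChar.sum_eq_ite, sub_eq_zero, AddEquiv.symm_apply_eq,
          Nat.card_eq_fintype_card]
    _ = if φ.symm χ ∈ Y then (Nat.card X : ℂ) else 0 := by
        simp only [Finset.sum_ite_eq, Set.mem_toFinset, SetLike.mem_coe]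

theorem card_mul_card_perp (φ : X ≃+ AddChar X ℂ) (Y : AddSubgroup X) :
    Nat.card Y * Nat.card (perp φ Y) = Nat.card X := by
  classical
  have h := card_mul_finsum_mem_perp φ Y 0
  rw [finsum_mem_addSubgroup_addChar, if_pos fun _ _ => AddChar.zero_apply _,
    map_zero, if_pos Y.zero_mem] at h
  exact_mod_cast h

theorem forall_mem_perp_eq_one_iff (φ : X ≃+ AddChar X ℂ) (Y : AddSubgroup X)
    (χ : AddChar X ℂ) : (∀ c ∈ perp φ Y, χ c = 1) ↔ φ.symm χ ∈ Y := by
  classical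
  have hY : (Nat.card Y : ℂ) ≠ 0 := Nat.cast_ne_zero.2 Nat.card_pos.ne'
  have hX : (Nat.card X : ℂ) ≠ 0 := Nat.cast_ne_zero.2 Nat.card_pos.ne'
  rw [← finsum_mem_addSubgroup_addChar_ne_zero_iff, ← mul_ne_zero_iff_left hY,
    card_mul_finsum_mem_perp, ite_ne_right_iff, and_iff_left hX]

theorem finsum_mem_finsum_mem_addChar_sub (C : Set X) (χ : AddChar X ℂ) :
    ∑ᶠ x ∈ C, ∑ᶠ y ∈ C, χ (y - x) = ((‖∑ᶠ x ∈ C, χ x‖ ^ 2 : ℝ) : ℂ) := by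
  classical
  have := Fintype.ofFinite X
  simp only [finsum_mem_eq_toFinset_sum, Complex.ofReal_pow, ← Complex.conj_mul', map_sum,
    Finset.sum_mul_sum, ← AddChar.map_neg_eq_conj, ← AddChar.map_add_eq_mul, neg_add_eq_sub]

open scoped Classical in
theorem sum_addChar_sum_mul_sum_sub (Z C : Finset X) (x : X) :
    ∑ χ : AddChar X ℂ, (∑ z ∈ Z, χ z) * ∑ c ∈ C, χ (x - c) =
      (Nat.card X : ℂ) * ({c ∈ C | c - x ∈ Z} : Finset X).card := by
  have := Fintype.ofFinite X
  calc ∑ χ : AddChar X ℂ, (∑ z ∈ Z, χ z) * ∑ c ∈ C, χ (x - c)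
      = ∑ c ∈ C, ∑ z ∈ Z, ∑ χ : AddChar X ℂ, χ (z + (x - c)) := by
        simp only [Finset.sum_mul_sum, ← AddChar.map_add_eq_mul]
        rw [← Finset.sum_comm_cycle, Finset.sum_comm]
    _ = ∑ c ∈ C, ∑ z ∈ Z, if c - x = z then (Nat.card X : ℂ) else 0 := by
        simp only [AddChar.sum_apply_eq_ite, add_eq_zero_iff_neg_eq', neg_sub,
          Nat.card_eq_fintype_card]
    _ = (Nat.card X : ℂ) * ({c ∈ C | c - x ∈ Z} : Finset X).card := by
        simp [Finset.sum_ite, mul_comm]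

end Characters

theorem linearIndependent_of_triangular {ι X K α : Type*} [Ring K] [NoZeroDivisors K]
    [LinearOrder α] {v : ι → X → K} (r : ι → α) (p : ι → X) (hdiag : ∀ i, v i (p i) ≠ 0)
    (hoff : ∀ i j, j ≠ i → r j ≤ r i → v j (p i) = 0) : LinearIndependent K v := by
  classical
  rw [linearIndependent_iff']
  intro s g hg
  by_contra! hne
  obtain ⟨i₀, hi₀, hgi₀⟩ := hne
  obtain ⟨i, hi, hmax⟩ := Finset.exists_max_image {i ∈ s | g i ≠ 0} r
    ⟨i₀, Finset.mem_filter.2 ⟨hi₀, hgi₀⟩⟩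
  obtain ⟨his, hgi⟩ := Finset.mem_filter.1 hi
  have hzero : ∀ j ∈ s, j ≠ i → g j * v j (p i) = 0 := by
    intro j hj hji
    by_cases hgj : g j = 0
    · rw [hgj, zero_mul]
    · rw [hoff i j hji (hmax j (Finset.mem_filter.2 ⟨hj, hgj⟩)), mul_zero]
  have heval : g i * v i (p i) = 0 := by
    rw [← Finset.sum_eq_single_of_mem i his hzero]
    simpa using congrFun hg (p i)
  exact mul_ne_zero hgi (hdiag i) heval

theorem ncard_image_eq_of_eq_iff_eq {α β γ : Type*} {f : α → β} {g : α → γ}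
    (h : ∀ a b, f a = f b ↔ g a = g b) (s : Set α) : (f '' s).ncard = (g '' s).ncard := by
  obtain rfl | hs := s.eq_empty_or_nonempty
  · simp only [Set.image_empty, Set.ncard_empty]
  have : Nonempty γ := ⟨g hs.some⟩
  obtain ⟨F, hF⟩ : ∃ F : β → γ, ∀ a, F (f a) = g a :=
    (Function.factorsThrough_iff g).1 (fun a b hab => (h a b).1 hab) |>.imp
      fun F hF a => (congrFun hF a).symm
  have hinj : Set.InjOn F (f '' s) := by
    rintro _ ⟨a, -, rfl⟩ _ ⟨b, -, rfl⟩ hab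
    rw [hF, hF] at hab
    exact (h a b).2 hab
  rw [← hinj.ncard_image, Set.image_image]
  simp only [hF]

theorem IsGraphical.exists_between {X : Type*} {d : X → X → ℝ} (hg : IsGraphical d)
    (htri : ∀ x y z, d x z ≤ d x y + d y z) {x c : X} {k : ℕ} (hk : 1 ≤ k)
    (hkd : k < d x c) : ∃ z, d x z = d x c - k ∧ d z c ≤ k := by
  induction k, hk using Nat.le_induction with
  | base =>
    obtain ⟨z, hxz, hzc⟩ := hg x c (by simpa using hkd)
    exact ⟨z, by simpa using hxz, by simpa using hzc.le⟩
  | succ k _ ih =>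
    push_cast at hkd ⊢
    obtain ⟨z, hxz, hzc⟩ := ih (by linarith)
    obtain ⟨w, hxw, hwz⟩ := hg x z (by linarith)
    exact ⟨w, by linarith, by linarith [htri w z c]⟩

theorem IsGraphical.exists_isLeast_image_natCast {X : Type*} {d : X → X → ℝ}
    (hg : IsGraphical d) (htri : ∀ x y z, d x z ≤ d x y + d y z) {C : Set X} {x : X} {ρ : ℝ}
    (hρ : IsLeast (d x '' C) ρ) {k : ℕ} (hk : 1 ≤ k) (hkρ : k < ρ) :
    ∃ z, IsLeast (d z '' C) k := by
  obtain ⟨⟨c, hc, rfl⟩, hmin⟩ := hρ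
  obtain ⟨z, hxz, hzc⟩ := hg.exists_between htri hk hkρ
  have hle : ∀ c' ∈ C, k ≤ d z c' := fun c' hc' => by
    linarith [htri x z c', hmin (Set.mem_image_of_mem _ hc')]
  exact ⟨z, ⟨c, hc, hzc.antisymm (hle c hc)⟩, Set.forall_mem_image.2 hle⟩

namespace AssocScheme

section Relations

variable {X : Type*} {n : ℕ} (R : AssocScheme X n)

/-- The index `i` of the relation `R_i` containing `(x, y)`. -/
noncomputable def index (x y : X) : Fin (n + 1) := (R.partition x y).choose

theorem rel_iff_index_eq (i : Fin (n + 1)) (x y : X) : R.rel i x y ↔ R.index x y = i :=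
  ⟨fun h => ((R.partition x y).choose_spec.2 i h).symm,
    fun h => h ▸ (R.partition x y).choose_spec.1⟩

theorem rel_index (x y : X) : R.rel (R.index x y) x y := (R.rel_iff_index_eq _ x y).2 rfl

theorem ncard_rel_left_eq_valency (i : Fin (n + 1)) (c : X) :
    {x : X | R.rel i x c}.ncard = R.valency i := by
  have h := R.card_eq (R.inv i) i 0 c c ((R.diag c c).2 rfl)
  simp only [R.rel_inv, and_self] at h
  rw [h, R.p_comm, valency]

theorem ncard_codeBall [Finite X] {d : X → X → ℝ} {δ : Fin (n + 1) → ℝ}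
    (hδ : ∀ i x y, R.rel i x y → d x y = δ i) (c : X) (t : ℝ) :
    (codeBall d c t).ncard = ∑ᶠ i ∈ {i : Fin (n + 1) | δ i ≤ t}, R.valency i := by
  have hball : codeBall d c t = ⋃ i ∈ {i : Fin (n + 1) | δ i ≤ t}, {x | R.rel i x c} := by
    ext x
    simp [codeBall, hδ _ _ _ (R.rel_index x c), rel_iff_index_eq]
  have hdisj : {i : Fin (n + 1) | δ i ≤ t}.PairwiseDisjoint fun i => {x | R.rel i x c} :=
    fun i _ j _ hij => Set.disjoint_left.2 fun x hi hj =>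
      hij (((R.rel_iff_index_eq i x c).1 hi).symm.trans ((R.rel_iff_index_eq j x c).1 hj))
  rw [hball, (Set.toFinite _).ncard_biUnion (fun _ _ => Set.toFinite _) hdisj]
  simp only [ncard_rel_left_eq_valency]

theorem card_le_ncard_mul_finsum_valency [Finite X] {d : X → X → ℝ} {δ : Fin (n + 1) → ℝ}
    (hδ : ∀ i x y, R.rel i x y → d x y = δ i) {C : Set X} {t : ℝ}
    (hcov : ∀ x, ∃ c ∈ C, d x c ≤ t) :
    Nat.card X ≤ C.ncard * ∑ᶠ i ∈ {i : Fin (n + 1) | δ i ≤ t}, R.valency i := by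
  have huniv : Set.univ = ⋃ c ∈ C, codeBall d c t :=
    (Set.eq_univ_of_forall fun x => by simpa [codeBall] using hcov x).symm
  calc Nat.card X = (⋃ c ∈ C, codeBall d c t).ncard := by rw [← Set.ncard_univ, huniv]
    _ ≤ ∑ᶠ c ∈ C, (codeBall d c t).ncard := C.toFinite.ncard_biUnion_le _
    _ = C.ncard * ∑ᶠ i ∈ {i : Fin (n + 1) | δ i ≤ t}, R.valency i := by
      simp only [R.ncard_codeBall hδ]
      rw [finsum_mem_eq_finite_toFinset_sum _ C.toFinite, Finset.sum_const, smul_eq_mul,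
        Set.ncard_eq_toFinset_card]

end Relations

section Duality

variable {X : Type*} {n : ℕ} [AddCommGroup X] {R : AssocScheme X n}

theorem rel_iff_sub_mem_cls (hR : R.IsTranslation) (i : Fin (n + 1)) (x y : X) :
    R.rel i x y ↔ y - x ∈ R.cls i := by
  rw [hR i x y (-x), cls, Set.mem_ofPred_eq, add_neg_cancel, sub_eq_add_neg]

theorem exists_rel_left (hR : R.IsTranslation) (i : Fin (n + 1)) (c : X) :
    ∃ x, R.rel i x c := by
  obtain ⟨x, y, hxy⟩ := R.nonempty i
  exact ⟨x + (c - y), by simpa using (hR i x y (c - y)).1 hxy⟩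

theorem dualDegree_eq (R : AssocScheme X n) (φ : X ≃+ AddChar X ℂ) (Y : AddSubgroup X) :
    R.dualDegree φ Y = ((fun y => R.dualClass (φ y)) '' Y \ {R.dualClass 0}).ncard := by
  refine congrArg Set.ncard (Set.ext fun γ => ?_)
  refine (and_congr_right fun _ => ⟨?_, ?_⟩).trans and_comm
  · rintro ⟨a, ha, b, hb, h⟩
    exact ⟨b - a, Y.sub_mem hb ha, (congrArg R.dualClass (map_sub φ b a)).trans h⟩
  · rintro ⟨y, hy, h⟩
    exact ⟨0, Y.zero_mem, y, hy, (congrArg R.dualClass (by simp)).trans h⟩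

theorem degree_eq (hR : R.IsTranslation) (Y : AddSubgroup X) :
    R.degree (Y : Set X) = (R.index 0 '' Y \ {0}).ncard := by
  refine congrArg Set.ncard (Set.ext fun i => ?_)
  refine (and_congr_right fun _ => ⟨?_, ?_⟩).trans and_comm
  · rintro ⟨a, ha, b, hb, h⟩
    exact ⟨b - a, Y.sub_mem hb ha,
      (R.rel_iff_index_eq i 0 _).1 ((rel_iff_sub_mem_cls hR i a b).1 h)⟩
  · rintro ⟨y, hy, h⟩
    exact ⟨0, Y.zero_mem, y, hy, (R.rel_iff_index_eq i 0 y).2 h⟩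

theorem degree_eq_dualDegree (hR : R.IsTranslation) {φ : X ≃+ AddChar X ℂ}
    (hφ : R.IsSelfDualVia φ) (Y : AddSubgroup X) :
    R.degree (Y : Set X) = R.dualDegree φ Y := by
  have hker : ∀ x y, R.index 0 x = R.index 0 y ↔ R.dualClass (φ x) = R.dualClass (φ y) := by
    intro x y
    rw [← hφ]
    simp [cls, rel_iff_index_eq, eq_comm]
  have hindex : (0 : Fin (n + 1)) ∈ R.index 0 '' Y :=
    ⟨0, Y.zero_mem, (R.rel_iff_index_eq 0 0 0).1 ((R.diag 0 0).2 rfl)⟩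
  have hclass : R.dualClass 0 ∈ (fun y => R.dualClass (φ y)) '' Y :=
    ⟨0, Y.zero_mem, congrArg R.dualClass (map_zero φ)⟩
  rw [degree_eq hR, dualDegree_eq, Set.ncard_sdiff_singleton_of_mem hindex,
    Set.ncard_sdiff_singleton_of_mem hclass, ncard_image_eq_of_eq_iff_eq hker]

theorem dualDistribution_eq [Finite X] (R : AssocScheme X n) (C : Set X) (γ : R.DualClass) :
    R.dualDistribution C γ = (((C.ncard : ℝ)⁻¹ *
      ∑ᶠ χ ∈ {χ | R.dualClass χ = γ}, ‖∑ᶠ x ∈ C, χ x‖ ^ 2 : ℝ) : ℂ) := by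
  classical
  have hcomm : ∑ᶠ x ∈ C, ∑ᶠ y ∈ C, ∑ᶠ χ ∈ {χ : AddChar X ℂ | R.dualClass χ = γ}, χ (y - x) =
      ∑ᶠ χ ∈ {χ : AddChar X ℂ | R.dualClass χ = γ}, ∑ᶠ x ∈ C, ∑ᶠ y ∈ C, χ (y - x) := by
    have := Fintype.ofFinite X
    simp only [finsum_mem_eq_toFinset_sum]
    exact Finset.sum_comm_cycle
  rw [dualDistribution, hcomm]
  simp only [finsum_mem_finsum_mem_addChar_sub, Complex.ofReal_mul, Complex.ofReal_inv,
    Complex.ofReal_natCast, finsum_mem_eq_toFinset_sum, Complex.ofReal_sum]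

theorem dualDistribution_ne_zero_iff [Finite X] (R : AssocScheme X n) (C : Set X)
    (γ : R.DualClass) :
    R.dualDistribution C γ ≠ 0 ↔ ∃ χ : AddChar X ℂ, R.dualClass χ = γ ∧ ∑ᶠ x ∈ C, χ x ≠ 0 := by
  classical
  rw [dualDistribution_eq, Complex.ofReal_ne_zero, finsum_mem_eq_toFinset_sum]
  constructor
  · contrapose!
    intro hzero
    rw [Finset.sum_eq_zero, mul_zero]
    intro χ hχ
    rw [hzero χ (by simpa using hχ), norm_zero, zero_pow two_ne_zero]
  · rintro ⟨χ, hχ, hne⟩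
    have hC : (C.ncard : ℝ) ≠ 0 :=
      Nat.cast_ne_zero.2 (nonempty_of_finsum_mem_ne_zero hne).ncard_pos.ne'
    refine mul_ne_zero (inv_ne_zero hC) (Finset.sum_pos' (fun _ _ => sq_nonneg _) ?_).ne'
    exact ⟨χ, Set.mem_toFinset.2 hχ, pow_pos (norm_pos_iff.2 hne) 2⟩

theorem externalDistance_perp [Finite X] (R : AssocScheme X n) (φ : X ≃+ AddChar X ℂ)
    (Y : AddSubgroup X) : R.externalDistance (perp φ Y : Set X) = R.dualDegree φ Y := by
  rw [dualDegree_eq, externalDistance]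
  refine congrArg Set.ncard (Set.ext fun γ => ?_)
  refine (and_congr_right fun _ => ?_).trans and_comm
  simp only [dualDistribution_ne_zero_iff, finsum_mem_addSubgroup_addChar_ne_zero_iff,
    forall_mem_perp_eq_one_iff]
  constructor
  · rintro ⟨χ, h, hχ⟩
    exact ⟨φ.symm χ, hχ, by simpa using h⟩
  · rintro ⟨y, hy, h⟩
    exact ⟨φ y, h, by simpa using hy⟩

end Duality

section OuterDistribution

variable {X : Type*} {n : ℕ}

/-- The columns `x ↦ |{c ∈ C | (x, c) ∈ R_i}|` of the outer distribution matrix of a code `C`,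
with complex entries because its rank is bounded by means of characters. -/
noncomputable def outerDistribution (R : AssocScheme X n) (C : Set X) (i : Fin (n + 1)) (x : X) :
    ℂ :=
  ({c ∈ C | R.rel i x c}.ncard : ℂ)

theorem outerDistribution_ne_zero_iff [Finite X] (R : AssocScheme X n) (C : Set X)
    (i : Fin (n + 1)) (x : X) : R.outerDistribution C i x ≠ 0 ↔ ∃ c ∈ C, R.rel i x c := by
  rw [outerDistribution, Nat.cast_ne_zero, ← Nat.pos_iff_ne_zero, Set.ncard_pos]
  rfl

variable [AddCommGroup X] {R : AssocScheme X n}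

/-- The eigenvalue `P_γ(i) = ∑_{x ∈ X_i} χ(x)`, `χ ∈ γ`, of the `i`-th adjacency matrix. -/
noncomputable def eigenvalue (R : AssocScheme X n) (i : Fin (n + 1)) : R.DualClass → ℂ :=
  Quotient.lift (fun χ => ∑ᶠ x ∈ R.cls i, χ x) fun _ _ h => h i

/-- `|X|` times the orthogonal projection of the indicator function of the code `C` onto the
common eigenspace of the adjacency matrices which is spanned by the characters in `γ`. -/
noncomputable def eigencomponent (R : AssocScheme X n) (C : Set X) (γ : R.DualClass) (x : X) :
    ℂ :=
  ∑ᶠ χ ∈ {χ : AddChar X ℂ | R.dualClass χ = γ}, ∑ᶠ c ∈ C, χ (x - c)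

variable [Finite X]

instance : Finite R.DualClass := Quotient.finite _

theorem eigencomponent_eq_zero {C : Set X} {γ : R.DualClass} (hγ : R.dualDistribution C γ = 0) :
    R.eigencomponent C γ = 0 := by
  classical
  have := Fintype.ofFinite X
  ext x
  refine finsum_mem_eq_zero_of_forall_eq_zero fun χ hχ => ?_
  have hsum : ∑ᶠ c ∈ C, χ c = 0 := by
    by_contra hne
    exact (R.dualDistribution_ne_zero_iff C γ).2 ⟨χ, hχ, hne⟩ hγ
  calc ∑ᶠ c ∈ C, χ (x - c) = χ x * starRingEnd ℂ (∑ᶠ c ∈ C, χ c) := by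
        simp only [finsum_mem_eq_toFinset_sum, map_sum, Finset.mul_sum, sub_eq_add_neg,
          AddChar.map_add_eq_mul, AddChar.map_neg_eq_conj]
    _ = 0 := by rw [hsum, map_zero, mul_zero]

theorem card_mul_outerDistribution (hR : R.IsTranslation) (C : Set X) (i : Fin (n + 1)) (x : X) :
    (Nat.card X : ℂ) * R.outerDistribution C i x =
      ∑ᶠ γ, R.eigenvalue i γ * R.eigencomponent C γ x := by
  classical
  have := Fintype.ofFinite X
  have := Fintype.ofFinite R.DualClass
  have hcount : R.outerDistribution C i x =
      (({c ∈ C.toFinset | c - x ∈ (R.cls i).toFinset} : Finset X).card : ℂ) := by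
    rw [outerDistribution, Set.ncard_eq_toFinset_card']
    congr 2
    ext c
    simp [rel_iff_sub_mem_cls hR]
  rw [hcount, ← sum_addChar_sum_mul_sum_sub, finsum_eq_sum_of_fintype,
    ← Finset.sum_fiberwise _ R.dualClass]
  refine Finset.sum_congr rfl fun γ _ => ?_
  rw [eigencomponent, finsum_mem_eq_toFinset_sum, Finset.mul_sum]
  refine Finset.sum_congr (by ext; simp) fun χ hχ => ?_
  obtain rfl : R.dualClass χ = γ := by simpa using hχ
  rw [← finsum_mem_eq_toFinset_sum, ← finsum_mem_eq_toFinset_sum]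
  rfl

theorem outerDistribution_mem_span (hR : R.IsTranslation) (C : Set X) (i : Fin (n + 1)) :
    R.outerDistribution C i ∈
      Submodule.span ℂ (R.eigencomponent C '' {γ | R.dualDistribution C γ ≠ 0}) := by
  have := Fintype.ofFinite R.DualClass
  have hX : (Nat.card X : ℂ) ≠ 0 := Nat.cast_ne_zero.2 Nat.card_pos.ne'
  have hexpand : R.outerDistribution C i =
      (Nat.card X : ℂ)⁻¹ • ∑ γ, R.eigenvalue i γ • R.eigencomponent C γ := by
    ext x
    rw [← inv_mul_cancel_left₀ hX (R.outerDistribution C i x), card_mul_outerDistribution hR,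
      finsum_eq_sum_of_fintype]
    simp
  rw [hexpand]
  refine Submodule.smul_mem _ _ (Submodule.sum_mem _ fun γ _ => Submodule.smul_mem _ _ ?_)
  by_cases hγ : R.dualDistribution C γ = 0
  · rw [eigencomponent_eq_zero hγ]
    exact Submodule.zero_mem _
  · exact Submodule.subset_span ⟨γ, hγ, rfl⟩

theorem finrank_outerDistribution_le (hR : R.IsTranslation) (C : Set X) :
    (Set.range (R.outerDistribution C)).finrank ℂ ≤ R.externalDistance C + 1 := by
  classical
  set S := {γ | R.dualDistribution C γ ≠ 0}
  have := Fintype.ofFinite S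
  have hext : R.externalDistance C = (S \ {R.dualClass 0}).ncard :=
    congrArg Set.ncard (Set.ext fun _ => and_comm)
  calc (Set.range (R.outerDistribution C)).finrank ℂ
      ≤ (R.eigencomponent C '' S).finrank ℂ :=
        Submodule.finrank_mono (Submodule.span_le.2
          (Set.range_subset_iff.2 (outerDistribution_mem_span hR C)))
    _ ≤ (R.eigencomponent C '' S).toFinset.card := finrank_span_le_card _
    _ = (R.eigencomponent C '' S).ncard := (Set.ncard_eq_toFinset_card' _).symm
    _ ≤ S.ncard := Set.ncard_image_le
    _ ≤ R.externalDistance C + 1 := by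
      rw [hext, ← Nat.sub_le_iff_le_add]
      exact Set.pred_ncard_le_ncard_sdiff_singleton S _

theorem ncard_le_externalDistance_add_one (hR : R.IsTranslation) {C : Set X} {α : Type*}
    [LinearOrder α] (r : Fin (n + 1) → α) {I : Set (Fin (n + 1))}
    (hI : ∀ i ∈ I, ∃ x, (∃ c ∈ C, R.rel i x c) ∧
      ∀ j ∈ I, j ≠ i → r j ≤ r i → ∀ c ∈ C, ¬ R.rel j x c) :
    I.ncard ≤ R.externalDistance C + 1 := by
  -- In the rows chosen for the `i ∈ I`, the columns in `I` are triangular with respect to `r`.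
  have := Fintype.ofFinite I
  choose! p hmem hoff using hI
  have hli : LinearIndependent ℂ fun i : I => R.outerDistribution C i :=
    linearIndependent_of_triangular (fun i : I => r i) (fun i : I => p i)
      (fun i => (R.outerDistribution_ne_zero_iff C i (p i)).2 (hmem i i.2))
      fun i j hji hr => by
        by_contra hne
        obtain ⟨c, hc, hrel⟩ := (R.outerDistribution_ne_zero_iff C j (p i)).1 hne
        exact hoff i i.2 j j.2 (fun h => hji (Subtype.ext h)) hr c hc hrel
  calc I.ncard = Fintype.card I := Nat.card_eq_fintype_card
    _ = (Set.range fun i : I => R.outerDistribution C i).finrank ℂ :=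
      (finrank_span_eq_card hli).symm
    _ ≤ (Set.range (R.outerDistribution C)).finrank ℂ :=
      Submodule.finrank_mono (Submodule.span_mono
        (Set.range_subset_iff.2 fun i => Set.mem_range_self (i : Fin (n + 1))))
    _ ≤ R.externalDistance C + 1 := finrank_outerDistribution_le hR C

end OuterDistribution

section CoveringRadius

variable {X : Type*} {n : ℕ} [AddCommGroup X] [Finite X] {R : AssocScheme X n}
  {d : X → X → ℝ} {δ : Fin (n + 1) → ℝ}

theorem dispersion_add_card_le (hR : R.IsTranslation) (hδ : ∀ i x y, R.rel i x y → d x y = δ i)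
    {C : Set X} (hC : C.Nonempty) {e : ℝ} (he : C.PairwiseDisjoint fun c => codeBall d c e)
    {T : Finset ℝ} (hT : ∀ t ∈ T, e < t ∧ ∃ x, IsLeast (d x '' C) t) :
    dispersion δ e + T.card ≤ R.externalDistance C + 1 := by
  have hlarge : ∀ t ∈ T, ∃ i, δ i = t ∧
      ∃ x, (∃ c ∈ C, R.rel i x c) ∧ ∀ c ∈ C, t ≤ d x c := by
    intro t ht
    obtain ⟨-, x, ⟨c, hc, rfl⟩, hmin⟩ := hT t ht
    exact ⟨R.index x c, (hδ _ _ _ (R.rel_index x c)).symm, x, ⟨c, hc, R.rel_index x c⟩,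
      Set.forall_mem_image.1 hmin⟩
  choose! f hf hx using hlarge
  set I : Set (Fin (n + 1)) := {i | 0 ≤ δ i ∧ δ i ≤ e}
  have hdisj : Disjoint I (f '' T) := by
    rw [Set.disjoint_right]
    rintro _ ⟨t, ht, rfl⟩ hi
    exact (hT t ht).1.not_ge (hf t ht ▸ hi.2)
  have hcard : (I ∪ f '' T).ncard = dispersion δ e + T.card := by
    rw [Set.ncard_union_eq hdisj, Set.InjOn.ncard_image (Set.LeftInvOn.injOn hf),
      Set.ncard_coe_finset]
    rfl
  rw [← hcard]
  refine ncard_le_externalDistance_add_one hR δ ?_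
  rintro i (hi | ⟨t, ht, rfl⟩)
  · obtain ⟨c, hc⟩ := hC
    obtain ⟨x, hxc⟩ := exists_rel_left hR i c
    refine ⟨x, ⟨c, hc, hxc⟩, fun j _ hji hle c' hc' hxc' => hji ?_⟩
    have hcc' : c = c' := he.elim_set hc hc' x ((hδ i x c hxc).trans_le hi.2)
      ((hδ j x c' hxc').trans_le (hle.trans hi.2))
    subst hcc'
    exact ((R.rel_iff_index_eq j x c).1 hxc').symm.trans ((R.rel_iff_index_eq i x c).1 hxc)
  · obtain ⟨x, hxc, hmin⟩ := hx t ht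
    refine ⟨x, hxc, ?_⟩
    rintro j hj hji hle c' hc' hxc'
    have htj : t ≤ δ j := hδ j x c' hxc' ▸ hmin c' hc'
    rcases hj with hj | ⟨u, hu, rfl⟩
    · exact (hT t ht).1.not_ge (htj.trans hj.2)
    · rw [hf t ht, hf u hu] at hle
      rw [hf u hu] at htj
      exact hji (congrArg f (hle.antisymm htj))

theorem exists_mem_dist_le_genExternalDistance (hR : R.IsTranslation)
    (hd : R.IsWeaklyMetric d δ) (hg : IsGraphical d) {C : Set X} (hC : C.Nonempty) {e : ℕ}
    (he : C.PairwiseDisjoint fun c => codeBall d c e) (x : X) :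
    ∃ c ∈ C, d x c ≤ (R.genExternalDistance (dispersion δ) C e : ℝ) := by
  obtain ⟨k, hk⟩ := Nat.exists_eq_add_of_le (show dispersion δ e ≤ R.externalDistance C + 1 by
    simpa using dispersion_add_card_le hR hd.const hC he (T := ∅) (by simp))
  have hμ : R.genExternalDistance (dispersion δ) C e = (e + k : ℕ) := by
    rw [genExternalDistance]
    omega
  rw [hμ, Int.cast_natCast]
  by_contra! hfar
  obtain ⟨c, hc, hmin⟩ := Set.exists_min_image C (d x) C.toFinite hC
  have hleast : IsLeast (d x '' C) (d x c) := ⟨⟨c, hc, rfl⟩, Set.forall_mem_image.2 hmin⟩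
  have hlarge : d x c ∉ (Finset.Ioc e (e + k)).image Nat.cast := by
    simp only [Finset.mem_image, Finset.mem_Ioc, not_exists, not_and]
    rintro j ⟨-, hj⟩ hjd
    exact (hfar c hc).not_ge (hjd ▸ Nat.cast_le.2 hj)
  have hcontra := dispersion_add_card_le hR hd.const hC he
    (T := insert (d x c) ((Finset.Ioc e (e + k)).image Nat.cast)) ?_
  · rw [Finset.card_insert_of_notMem hlarge, Finset.card_image_of_injective _ Nat.cast_injective,
      Nat.card_Ioc] at hcontra
    omega
  · intro t ht
    obtain rfl | ht := Finset.mem_insert.1 ht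
    · exact ⟨(Nat.cast_le.2 (Nat.le_add_right e k)).trans_lt (hfar c hc), x, hleast⟩
    · obtain ⟨j, hj, rfl⟩ := Finset.mem_image.1 ht
      obtain ⟨hej, hjk⟩ := Finset.mem_Ioc.1 hj
      exact ⟨Nat.cast_lt.2 hej, hg.exists_isLeast_image_natCast hd.triangle hleast (by omega)
        ((Nat.cast_le.2 hjk).trans_lt (hfar c hc))⟩

end CoveringRadius

end AssocScheme

theorem mainTheorem8_general {X : Type*} [AddCommGroup X] [Finite X] {n : ℕ}
    (R : AssocScheme X n) (hR : R.IsTranslation)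
    (d : X → X → ℝ) (δ : Fin (n + 1) → ℝ) (hd : R.IsWeaklyMetric d δ) (hg : IsGraphical d)
    (φ : X ≃+ AddChar X ℂ) (Y : AddSubgroup X)
    (s : ℕ) (hs : R.dualDegree φ Y = s)
    (e : ℕ) (he : (perp φ Y : Set X).PairwiseDisjoint fun c => codeBall d c e) :
    (R.genExternalDistance (dispersion δ) (perp φ Y : Set X) e
        = (s : ℤ) - (dispersion δ e : ℤ) + (e : ℤ) + 1) ∧
    (Nat.card Y ≤
      ∑ᶠ i ∈ {i : Fin (n + 1) | δ i ≤ (((s : ℤ) - (dispersion δ e : ℤ) + (e : ℤ) + 1 : ℤ) : ℝ)},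
        R.valency i) ∧
    (R.IsSelfDualVia φ → R.degree (Y : Set X) = s) := by
  subst hs
  have hμ : R.genExternalDistance (dispersion δ) (perp φ Y : Set X) e =
      (R.dualDegree φ Y : ℤ) - dispersion δ e + e + 1 := by
    rw [AssocScheme.genExternalDistance, AssocScheme.externalDistance_perp]
  refine ⟨hμ, ?_, fun hφ => AssocScheme.degree_eq_dualDegree hR hφ Y⟩
  have hcov := AssocScheme.exists_mem_dist_le_genExternalDistance hR hd hg
    ⟨0, (perp φ Y).zero_mem⟩ he
  have hcard := R.card_le_ncard_mul_finsum_valency hd.const hcov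
  rw [hμ, ← card_mul_card_perp φ Y, mul_comm] at hcard
  exact Nat.le_of_mul_le_mul_left hcard Nat.card_pos

theorem mainTheorem8 {X : Type*} [AddCommGroup X] [Fintype X] [Nontrivial X] {n : ℕ}
    (R : AssocScheme X n) (hR : R.IsTranslation)
    (d : X → X → ℝ) (δ : Fin (n + 1) → ℝ) (hd : R.IsWeaklyMetric d δ) (hg : IsGraphical d)
    (φ : X ≃+ AddChar X ℂ) (Y : AddSubgroup X)
    (s : ℕ) (hs : R.dualDegree φ Y = s)
    (e : ℕ) (he : IsPackingRadius d (perp φ Y : Set X) e) :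
    (R.genExternalDistance (dispersion δ) (perp φ Y : Set X) e
        = (s : ℤ) - (dispersion δ e : ℤ) + (e : ℤ) + 1) ∧
    (Nat.card Y ≤
      ∑ᶠ i ∈ {i : Fin (n + 1) | δ i ≤ (((s : ℤ) - (dispersion δ e : ℤ) + (e : ℤ) + 1 : ℤ) : ℝ)},
        R.valency i) ∧
    (R.IsSelfDualVia φ → R.degree (Y : Set X) = s) :=
  mainTheorem8_general R hR d δ hd hg φ Y s hs e he.1
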